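/- Let $\mathbb T^2=\mathbb R^2/\mathbb Z^2$ and equip $T^*\mathbb T^2=\mathbb T^2\times\mathbb R^2$, with coordinates $(q,p)$, with $\lambda=p_1\,dq_1+p_2\,dq_2$. Let $A\subset\mathbb R^2$ be a compact domain which is star-shaped about the origin $0\in\operatorname{int}A$ and whose boundary is of class $C^1$ and transverse to the radial direction, i.e. $p\cdot n(p)>0$ for the outer normal $n(p)$ at every $p\in\partial A$. Put $Y=\mathbb T^2\times\partial A$ and $\xi=\ker(\lambda|_Y)$. The Reeb vector field $R$ on $Y$ is given by $\lambda(R)=1$, $d\lambda(R,\cdot)|_{TY}=0$; a closed Reeb orbit is a periodic orbit of $R$ of some period $T>0$ (not necessarily minimal). The form $\lambda|_Y$ is called dynamically convex if either it has no contractible closed Reeb orbit, or every contractible closed Reeb orbit has Conley–Zehnder index at least $3$ with respect to trivializations of $\xi$ that extend over a bounding disk (the index being extended to degenerate orbits by lower semicontinuity). 1. Every closed Reeb orbit of $\lambda|_Y$ is non-contractible in $Y$. In particular $\lambda|_Y$ is dynamically convex. 2. Assume moreover that $\partial A$ is of class $C^2$ (for instance smooth). Trivialize $\xi$ by the frame $e_1=p_2\partial_{q_1}-p_1\partial_{q_2}$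 and $e_2$, the Euclidean unit vector tangent to $\{q\}\times\partial A$ with $d\lambda(e_1,e_2)>0$. Then the matrix in this frame of the linearized Reeb flow $d\phi^t_R|_{\xi_y}$ is, for every $y\in Y$, of the form $\begin{pmatrix}1&\kappa t\\0&1\end{pmatrix}$ for all $t\in\mathbb R$, with $\kappa\in\mathbb R$ depending only on $y$. Let $\Psi_t(y)\in \mathrm{Sp}(2)$ denote this matrix and, for $T>0$, let $\rho(\{\Psi_t(y)\}_{t\in[0,T]})$ be its rotation number, i.e. the translation number of the lifted action on angles, measured in full turns. Then the Ruelle invariant $$\mathrm{Ru}(Y)=\int_Y \Big(\lim_{T\to\infty}\frac{\rho(\{\Psi_t(y)\}_{t\in[0,T]})}{T}\Big)\,\lambda\wedge d\lambda$$ is well defined and equal to $0$. -/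

import Mathlib

open MeasureTheory Filter Topology Set
open scoped Matrix

namespace CotangentTorus

noncomputable section

/-- The Euclidean plane. -/
abbrev Plane : Type := EuclideanSpace ℝ (Fin 2)

/-- The torus `ℝ/ℤ × ℝ/ℤ`. -/
abbrev Torus : Type := Fin 2 → UnitAddCircle

/-- The cotangent bundle of the torus in its global coordinates `(q, p)`. -/
abbrev Phase : Type := Torus × Plane

/-- Tangent vectors to the cotangent bundle of the torus: a vector `v` stands for
`∑ i, v.1 i ∂_{q_i} + v.2 i ∂_{p_i}`. -/
abbrev TVec : Type := Plane × Plane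

/-- The universal covering of the cotangent bundle of the torus. -/
def proj (x : Plane × Plane) : Phase := (fun i => (x.1 i : UnitAddCircle), x.2)

/-- The curve `γ` is differentiable at time `t` with velocity `v`: near `t` it lifts to the
universal covering, and the lift has derivative `v` at `t`. -/
def HasVelocityAt (γ : ℝ → Phase) (v : TVec) (t : ℝ) : Prop :=
  ∃ c : ℝ → Plane × Plane, HasDerivAt c v t ∧ ∀ᶠ s in 𝓝 t, proj (c s) = γ s

/-- The tangent vectors at `y` to a submanifold `Y`: velocities of curves in `Y` through `y`. -/
def tangentVectors (Y : Set Phase) (y : Phase) : Set TVec :=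
  {v | ∃ r : ℝ → Phase, (∀ s, r s ∈ Y) ∧ r 0 = y ∧ HasVelocityAt r v 0}

/-- The canonical one-form `λ = ∑ i, p_i dq_i`. -/
def lam (y : Phase) (v : TVec) : ℝ := ∑ i, y.2 i * v.1 i

/-- The two-form `dλ = ∑ i, dp_i ∧ dq_i`, which is the canonical symplectic form. -/
def dlam (u v : TVec) : ℝ := ∑ i, (u.2 i * v.1 i - v.2 i * u.1 i)

/-- The three-form `λ ∧ dλ`. -/
def lamWedge (y : Phase) (u v w : TVec) : ℝ :=
  lam y u * dlam v w + lam y v * dlam w u + lam y w * dlam u v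

/-- The contact plane `ker (λ|_{T_y Y})`. -/
def contactPlane (Y : Set Phase) (y : Phase) : Set TVec :=
  {v | v ∈ tangentVectors Y y ∧ lam y v = 0}

/-- `v` is the Reeb vector of `λ|_Y` at `y`: it is tangent to `Y`, `λ(v) = 1`, and `dλ(v, ·)`
vanishes on the tangent space of `Y`. -/
structure IsReebVector (Y : Set Phase) (y : Phase) (v : TVec) : Prop where
  tangent : v ∈ tangentVectors Y y
  lam_eq : lam y v = 1
  dlam_eq : ∀ w ∈ tangentVectors Y y, dlam v w = 0

/-- `φ` is the flow on `Y` of the Reeb vector field of `λ|_Y` (values outside `Y` are ignored). -/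
structure IsReebFlow (Y : Set Phase) (φ : ℝ → Phase → Phase) : Prop where
  mem : ∀ t, ∀ y ∈ Y, φ t y ∈ Y
  zero : ∀ y ∈ Y, φ 0 y = y
  velocity : ∀ y ∈ Y, ∀ t, ∃ v, IsReebVector Y (φ t y) v ∧ HasVelocityAt (fun s => φ s y) v t

/-- A closed Reeb orbit of period `T` (not necessarily the minimal one). -/
def IsClosedReebOrbit (Y : Set Phase) {T : ℝ} (γ : C(AddCircle T, Y)) : Prop :=
  ∀ t : ℝ, ∃ v, IsReebVector Y (γ (t : AddCircle T)) v ∧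
    HasVelocityAt (fun s : ℝ => (γ (s : AddCircle T) : Phase)) v t

/-- `M` is the matrix of the differential at `y` of the map `F : Y → Y`, restricted to the plane
spanned by the frame `f`, with respect to the frame `f` at `y` and the frame `f'` at `F y`. -/
def HasLinearizedMatrix (Y : Set Phase) (F : Phase → Phase) (y : Phase) (f f' : Fin 2 → TVec)
    (M : Matrix (Fin 2) (Fin 2) ℝ) : Prop :=
  ∀ (a : Fin 2 → ℝ) (r : ℝ → Phase), (∀ s, r s ∈ Y) → r 0 = y →
    HasVelocityAt r (∑ i, a i • f i) 0 → HasVelocityAt (F ∘ r) (∑ i, (M *ᵥ a) i • f' i) 0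

/-! ### Rotation number and Conley-Zehnder index of a path of symplectic 2 × 2 matrices -/

/-- The unit vector at angle `x`, measured in full turns. -/
def dir (x : ℝ) : Fin 2 → ℝ := ![Real.cos (2 * Real.pi * x), Real.sin (2 * Real.pi * x)]

/-- `F` is the lift to angles (in full turns) of the action on directions of the element of the
universal cover of `Sp(2)` represented by the path `Ψ` on `[0, T]` starting at the identity:
following the direction of `Ψ t (dir x)` continuously, the angle goes from `x` to `F x`. -/
def IsAngleLift (Ψ : ℝ → Matrix (Fin 2) (Fin 2) ℝ) (T : ℝ) (F : ℝ → ℝ) : Prop :=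
  ∀ x, ∃ a : ℝ → ℝ, ContinuousOn a (Icc 0 T) ∧ a 0 = x ∧ a T = F x ∧
    ∀ t ∈ Icc 0 T, ∃ c : ℝ, 0 < c ∧ Ψ t *ᵥ dir x = c • dir (a t)

/-- The rotation number of the path `Ψ` on `[0, T]` is `ρ`: it is the translation number of the
lifted action on angles, normalized so that a full positive turn has rotation number `1`. -/
def HasRotationNumber (Ψ : ℝ → Matrix (Fin 2) (Fin 2) ℝ) (T ρ : ℝ) : Prop :=
  ∃ F : CircleDeg1Lift, IsAngleLift Ψ T F ∧ F.translationNumber = ρ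

/-- The path `Ψ` on `[0, T]` has Conley-Zehnder index `m`. With `I` the interval of all rotation
angles `F x - x`, the index is `2k` if `k ∈ I - ε` and `2k + 1` if `I - ε ⊆ (k, k + 1)`, for all
small `ε > 0`. For nondegenerate paths this is the usual index, and in general it is its maximal
lower semicontinuous extension. -/
def HasCZIndex (Ψ : ℝ → Matrix (Fin 2) (Fin 2) ℝ) (T : ℝ) (m : ℤ) : Prop :=
  ∃ F : ℝ → ℝ, IsAngleLift Ψ T F ∧
    ((∃ k : ℤ, m = 2 * k ∧ ∀ᶠ ε : ℝ in 𝓝[>] 0, ∃ x, F x - x - ε = k) ∨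
      (∃ k : ℤ, m = 2 * k + 1 ∧
        ∀ᶠ ε : ℝ in 𝓝[>] 0, ∀ x, (k : ℝ) < F x - x - ε ∧ F x - x - ε < k + 1))

/-! ### Dynamical convexity -/

/-- The closed unit disk. -/
abbrev Disk : Type := Metric.closedBall (0 : ℂ) 1

/-- The boundary point `exp (2 π i s / T)` of the disk. -/
def diskBoundary {T : ℝ} (s : AddCircle T) : Disk := 
  ⟨(AddCircle.toCircle s : ℂ), by
    rw [mem_closedBall_zero_iff]; exact (Circle.norm_coe _).le⟩

/-- `u` is a disk in `Y` bounding the loop `γ`, and `f` is a symplectic trivialization of the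
contact plane field over this disk. -/
structure IsFramedSpanningDisk (Y : Set Phase) {T : ℝ} (γ : C(AddCircle T, Y)) (u : C(Disk, Y))
    (f : Disk → Fin 2 → TVec) : Prop where
  boundary : ∀ s, u (diskBoundary s) = γ s
  continuous : Continuous f
  mem : ∀ z i, f z i ∈ contactPlane Y (u z)
  symplectic : ∀ z, dlam (f z 0) (f z 1) = 1

/-- The closed Reeb orbit `γ` has Conley-Zehnder index `m` with respect to the trivialization
of the contact plane field along `γ` obtained by restricting `f` to the boundary of the disk. -/
def OrbitHasCZIndex (Y : Set Phase) (φ : ℝ → Phase → Phase) {T : ℝ} (γ : C(AddCircle T, Y))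
    (f : Disk → Fin 2 → TVec) (m : ℤ) : Prop :=
  ∃ Ψ : ℝ → Matrix (Fin 2) (Fin 2) ℝ,
    (∀ t ∈ Icc 0 T, HasLinearizedMatrix Y (φ t) (γ 0)
      (f (diskBoundary (0 : AddCircle T))) (f (diskBoundary (t : AddCircle T))) (Ψ t)) ∧
    HasCZIndex Ψ T m

/-- No closed Reeb orbit of `λ|_Y` is contractible in `Y`. -/
def NoContractibleReebOrbit (Y : Set Phase) : Prop :=
  ∀ T : ℝ, 0 < T → ∀ γ : C(AddCircle T, Y), IsClosedReebOrbit Y γ → ¬ γ.Nullhomotopic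

/-- `λ|_Y` is dynamically convex: either it has no contractible closed Reeb orbit, or every
contractible closed Reeb orbit has Conley-Zehnder index at least `3` with respect to
trivializations that extend over a bounding disk. -/
def IsDynamicallyConvex (Y : Set Phase) : Prop :=
  NoContractibleReebOrbit Y ∨
    ∃ φ, IsReebFlow Y φ ∧ ∀ T : ℝ, 0 < T → ∀ γ : C(AddCircle T, Y), IsClosedReebOrbit Y γ →
      γ.Nullhomotopic → ∀ u f, IsFramedSpanningDisk Y γ u f → ∃ m, OrbitHasCZIndex Y φ γ f m ∧ 3 ≤ m

/-! ### Product domains and the Ruelle invariant -/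

/-- `A` is a compact star-shaped domain in the plane with boundary of class `C^k`: it is
star-shaped about the interior point `0`, and near each boundary point `p` it is the sublevel set
of a `C^k` function with outward gradient `∇f(p)`, where the radial direction is transverse to the
boundary, i.e. `⟨p, ∇f(p)⟩ > 0`. -/
structure IsStarShapedDomain (k : WithTop ℕ∞) (A : Set Plane) : Prop where
  isCompact : IsCompact A
  zero_mem : 0 ∈ interior A
  starConvex : StarConvex ℝ 0 A
  boundary : ∀ p ∈ frontier A, ∃ f : Plane → ℝ, ContDiffAt ℝ k f p ∧
    (∀ᶠ x in 𝓝 p, x ∈ A ↔ f x ≤ 0) ∧ 0 < fderiv ℝ f p p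

/-- The boundary `𝕋² × ∂A` of the product domain `𝕋² × A`. -/
def productBoundary (A : Set Plane) : Set Phase := {y | y.2 ∈ frontier A}

/-- `(f 0, f 1)` is the ordered basis of the contact plane at `y` that defines the fixed global
trivialization: `f 0 = p₂ ∂_{q₁} - p₁ ∂_{q₂}`, and `f 1` is the Euclidean unit vector tangent to
the fibre of `Y` with `dλ (f 0, f 1) > 0`. -/
structure IsCanonicalFrame (Y : Set Phase) (y : Phase) (f : Fin 2 → TVec) : Prop where
  first : f 0 = (!₂[y.2 1, -y.2 0], 0)
  tangent : f 1 ∈ tangentVectors Y y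
  vertical : (f 1).1 = 0
  unit : ‖(f 1).2‖ = 1
  orientation : 0 < dlam (f 0) (f 1)

/-- The measure on `𝕋² × ∂A` defined by the volume form `λ ∧ dλ`: its density with respect to
the product of the Haar measure and the arc length is the absolute value of `λ ∧ dλ` on the
orthonormal basis `∂_{q₁}, ∂_{q₂}, τ y 1` of the tangent space. -/
def contactVolume (A : Set Plane) (τ : Phase → Fin 2 → TVec) : Measure Phase :=
  ((volume : Measure Torus).prod
    ((Measure.hausdorffMeasure 1 : Measure Plane).restrict (frontier A))).withDensity
      fun y => ENNReal.ofReal |lamWedge y (!₂[1, 0], 0) (!₂[0, 1], 0) (τ y 1)|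

/-- In the trivialization `τ`, the linearized Reeb flow at `y` rotates at the asymptotic rate
`r`: `r` is the limit as `T → ∞` of `1 / T` times the rotation number up to time `T`. -/
def HasRotationRate (Y : Set Phase) (φ : ℝ → Phase → Phase) (τ : Phase → Fin 2 → TVec)
    (y : Phase) (r : ℝ) : Prop :=
  ∃ Ψ : ℝ → Matrix (Fin 2) (Fin 2) ℝ,
    (∀ t, 0 ≤ t → HasLinearizedMatrix Y (φ t) y (τ y) (τ (φ t y)) (Ψ t)) ∧
    ∃ ρ : ℝ → ℝ, (∀ T, 0 < T → HasRotationNumber Ψ T (ρ T)) ∧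
      Tendsto (fun T => ρ T / T) atTop (𝓝 r)

/-- The Ruelle invariant of `(𝕋² × ∂A, λ)` is well defined and equal to `c`: it is the integral
over `𝕋² × ∂A` of the rotation rate against `λ ∧ dλ`. -/
def HasRuelleInvariant (A : Set Plane) (c : ℝ) : Prop :=
  ∃ (φ : ℝ → Phase → Phase) (τ : Phase → Fin 2 → TVec) (rot : Phase → ℝ),
    IsReebFlow (productBoundary A) φ ∧
    (∀ y ∈ productBoundary A, IsCanonicalFrame (productBoundary A) y (τ y)) ∧
    (∀ᵐ y ∂(contactVolume A τ), HasRotationRate (productBoundary A) φ τ y (rot y)) ∧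
    Integrable rot (contactVolume A τ) ∧
    ∫ y, rot y ∂(contactVolume A τ) = c

end

end CotangentTorus

namespace CotangentTorus

/-! ### Velocities and lifts of curves -/

/-! Non-contractibility. Torus translations preserve `Y`, so `(v.2, 0)` is tangent for a Reeb vector
`v`; the Reeb equation gives `dlam v (v.2, 0) = |v.2|² = 0`, so `p` is constant along orbits
(`IsReebVector.snd_eq_zero`). The integral of `λ` over a closed orbit, which is its period, is then
`∑ pᵢ Δqᵢ`. On a contractible loop the `qᵢ` lift to real-valued functions on the loop, so `Δqᵢ = 0`,
contradicting `T > 0`. Dynamical convexity holds by its first alternative.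

Ruelle invariant. If `f` cuts out `∂A` locally, the Reeb vector is `R(p) = ∇f / ⟨p, ∇f⟩` and the
flow is `(q, p) ↦ (q + t R(p), p)` (`reebFlow_apply`). Its differential adds `t DR(p) w` to the
`q`-part. Differentiating `⟨p, R(p)⟩ = 1` along a tangent `w`, where `⟨w, R⟩ = 0`, gives `⟨p, DR w⟩
= 0`; so `DR w` is a multiple of the first frame vector, and the linearized flow is a shear
(`exists_fderiv_reebDirection`, `hasLinearizedMatrix_reebFlow`). A path of shears fixes one
direction throughout, so its angle lift has a fixed point and translation number `0`
(`hasRotationNumber_shear_iff`). The rotation rate vanishes on all of `Y`, and so does its integral.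
-/

theorem eventually_sub_eq_of_coe_eq {c d : ℝ → ℝ} {t : ℝ} (hc : ContinuousAt c t)
    (hd : ContinuousAt d t) (h : ∀ᶠ s in 𝓝 t, (c s : UnitAddCircle) = d s) :
    ∀ᶠ s in 𝓝 t, c s - d s = c t - d t := by
  have key : ∀ s, (c s : UnitAddCircle) = d s → ∃ n : ℤ, (n : ℝ) = c s - d s := fun s hs => by
    rw [← sub_eq_zero, ← AddCircle.coe_sub, AddCircle.coe_eq_zero_iff] at hs
    simpa using hs
  obtain ⟨n, hn⟩ := key t h.self_of_nhds
  have hnear := Metric.tendsto_nhds.1 (hc.sub hd) 1 one_pos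
  filter_upwards [h, hnear] with s hs hs'
  obtain ⟨m, hm⟩ := key s hs
  rw [Pi.sub_apply, Pi.sub_apply, ← hm, ← hn, Real.dist_eq] at hs'
  rw [← hm, ← hn]
  have : |m - n| < 1 := by exact_mod_cast hs'
  have := Int.abs_lt_one_iff.1 this
  congr 1
  lia

theorem proj_eq_proj_iff {x y : Plane × Plane} :
    proj x = proj y ↔ (∀ i, (x.1 i : UnitAddCircle) = y.1 i) ∧ x.2 = y.2 := by
  simp [proj, Prod.ext_iff, funext_iff]

theorem proj_add_eq_proj_add {x y : Plane × Plane} (h : proj x = proj y) (z : Plane × Plane) :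
    proj (x + z) = proj (y + z) := by
  rw [proj_eq_proj_iff] at h ⊢
  refine ⟨fun i => ?_, by simp [h.2]⟩
  simp [h.1 i]

theorem exists_proj_eq (y : Phase) : ∃ x, proj x = y := by
  choose b hb using fun i => QuotientAddGroup.mk_surjective (y.1 i)
  exact ⟨(WithLp.toLp 2 b, y.2), Prod.ext (funext hb) rfl⟩

theorem continuous_proj : Continuous proj := by
  refine .prodMk (continuous_pi fun i => ?_) continuous_snd
  exact (AddCircle.continuous_mk' 1).comp (by fun_prop)

/-- Two lifts of the same curve that are continuous at `t` differ by a constant near `t`. -/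
theorem eventually_sub_eq_of_proj_eq {c d : ℝ → Plane × Plane} {t : ℝ} (hc : ContinuousAt c t)
    (hd : ContinuousAt d t) (h : ∀ᶠ s in 𝓝 t, proj (c s) = proj (d s)) :
    ∀ᶠ s in 𝓝 t, c s = d s + (c t - d t) := by
  have hi : ∀ i, ∀ᶠ s in 𝓝 t, (c s).1 i - (d s).1 i = (c t).1 i - (d t).1 i := fun i =>
    eventually_sub_eq_of_coe_eq (c := fun s => (c s).1 i) (d := fun s => (d s).1 i)
      (by fun_prop) (by fun_prop) (h.mono fun s hs => (proj_eq_proj_iff.1 hs).1 i)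
  have ht := (proj_eq_proj_iff.1 h.self_of_nhds).2
  filter_upwards [eventually_all.2 hi, h] with s hs hs'
  ext i
  · have := hs i
    simp only [Prod.fst_add, Prod.fst_sub, PiLp.add_apply, PiLp.sub_apply]
    linarith
  · simp [(proj_eq_proj_iff.1 hs').2, ht]

/-- The existential in `HasVelocityAt` is harmless: continuous lifts differ locally by a constant,
so every one of them has the same derivative. -/
theorem HasVelocityAt.hasDerivAt_lift {γ : ℝ → Phase} {v : TVec} {t : ℝ} (h : HasVelocityAt γ v t)
    {c : ℝ → Plane × Plane} (hc : ContinuousAt c t) (hcγ : ∀ᶠ s in 𝓝 t, proj (c s) = γ s) :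
    HasDerivAt c v t := by
  obtain ⟨d, hd, hdγ⟩ := h
  refine (hd.add_const (c t - d t)).congr_of_eventuallyEq ?_
  refine eventually_sub_eq_of_proj_eq hc hd.continuousAt ?_
  filter_upwards [hcγ, hdγ] with s h₁ h₂ using h₁.trans h₂.symm

theorem HasVelocityAt.unique {γ : ℝ → Phase} {v w : TVec} {t : ℝ} (hv : HasVelocityAt γ v t)
    (hw : HasVelocityAt γ w t) : v = w := by
  obtain ⟨c, hc, hcγ⟩ := hv
  exact hc.unique (hw.hasDerivAt_lift hc.continuousAt hcγ)

theorem HasVelocityAt.continuousAt {γ : ℝ → Phase} {v : TVec} {t : ℝ} (h : HasVelocityAt γ v t) :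
    ContinuousAt γ t := by
  obtain ⟨c, hc, hcγ⟩ := h
  exact (continuous_proj.continuousAt.comp hc.continuousAt).congr hcγ

theorem exists_lift_unitAddCircle (g : C(ℝ, UnitAddCircle)) :
    ∃ c : C(ℝ, ℝ), ∀ t, (c t : UnitAddCircle) = g t := by
  obtain ⟨e, he⟩ := QuotientAddGroup.mk_surjective (g 0)
  obtain ⟨F, ⟨-, hF⟩, -⟩ := (AddCircle.isCoveringMap_coe (1 : ℝ)).existsUnique_continuousMap_lifts
    g (0 : ℝ) e he
  exact ⟨F, fun t => congrFun hF t⟩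

/-- A curve that has a velocity at every time lifts to a differentiable curve. -/
theorem exists_lift_of_hasVelocityAt {γ : ℝ → Phase} {v : ℝ → TVec}
    (h : ∀ t, HasVelocityAt γ (v t) t) :
    ∃ c : ℝ → Plane × Plane, ∀ t, HasDerivAt c (v t) t ∧ proj (c t) = γ t := by
  have hγ : Continuous γ := continuous_iff_continuousAt.2 fun t => (h t).continuousAt
  choose b hb using fun i =>
    exists_lift_unitAddCircle ⟨fun t => (γ t).1 i, (continuous_apply i).comp hγ.fst⟩
  refine ⟨fun t => (WithLp.toLp 2 fun i => b i t, (γ t).2), fun t => ?_⟩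
  have hp : ∀ t, proj (WithLp.toLp 2 fun i => b i t, (γ t).2) = γ t := fun t => by
    ext i
    · exact hb i t
    · rfl
  refine ⟨(h t).hasDerivAt_lift ?_ (.of_forall hp), hp t⟩
  refine (Continuous.prodMk ?_ hγ.snd).continuousAt
  exact (PiLp.continuous_toLp 2 _).comp (continuous_pi fun i => (b i).continuous)

/-- A nullhomotopic loop in the circle lifts to a loop in the line. -/
theorem exists_lift_of_nullhomotopic {X : Type*} [TopologicalSpace X] {g : C(X, UnitAddCircle)}
    (hg : g.Nullhomotopic) : ∃ c : C(X, ℝ), ∀ x, (c x : UnitAddCircle) = g x := by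
  obtain ⟨y, ⟨F⟩⟩ := hg
  obtain ⟨e, rfl⟩ := QuotientAddGroup.mk_surjective y
  have cov := AddCircle.isCoveringMap_coe (1 : ℝ)
  have h0 : ∀ x, F.symm (0, x) = ((ContinuousMap.const X e x : ℝ) : UnitAddCircle) := fun x => by
    simp
  -- The reversed homotopy starts at a constant map, which lifts to the constant `e`; the lifted
  -- homotopy at time `1` lifts `g`.
  refine ⟨(cov.liftHomotopy (F.symm : C(_, _)) (.const X e) h0).comp
    (.prodMk (.const X 1) (.id X)), fun x => ?_⟩
  have := congrFun (cov.liftHomotopy_lifts (F.symm : C(_, _)) (.const X e) h0) (1, x)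
  simpa using this

/-! ### Closed Reeb orbits are not contractible -/

/-- Only translation invariance in `q` is used, so no regularity of the frontier is needed. -/
theorem IsReebVector.snd_eq_zero {A : Set Plane} {y : Phase} {v : TVec}
    (hy : y ∈ productBoundary A) (h : IsReebVector (productBoundary A) y v) : v.2 = 0 := by
  obtain ⟨x, hx⟩ := exists_proj_eq y
  have key : dlam v (v.2, 0) = 0 := by
    refine h.dlam_eq _ ⟨fun s => proj (x + s • (v.2, 0)), fun s => ?_, by simp [hx],
      fun s => x + s • (v.2, 0), ?_, .of_forall fun _ => rfl⟩
    · have : x.2 = y.2 := by rw [← hx]; rfl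
      simpa [productBoundary, proj, this] using hy
    · simpa using ((hasDerivAt_id (0 : ℝ)).smul_const ((v.2, 0) : TVec)).const_add x
  simp only [dlam, Fin.sum_univ_two, PiLp.zero_apply, zero_mul, sub_zero] at key
  ext i
  fin_cases i
  · exact mul_self_eq_zero.1 (le_antisymm (by simp; nlinarith [mul_self_nonneg (v.2 1)])
      (mul_self_nonneg _))
  · exact mul_self_eq_zero.1 (le_antisymm (by simp; nlinarith [mul_self_nonneg (v.2 0)])
      (mul_self_nonneg _))

theorem snd_eq_of_hasVelocityAt {γ : ℝ → Phase} {v : ℝ → TVec}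
    (h : ∀ t, HasVelocityAt γ (v t) t) (hv : ∀ t, (v t).2 = 0) (s t : ℝ) : (γ s).2 = (γ t).2 := by
  obtain ⟨c, hc⟩ := exists_lift_of_hasVelocityAt h
  have hd : ∀ t, HasDerivAt (fun s => (c s).2) 0 t := fun t => by
    have : HasDerivAt (Prod.snd ∘ c) (v t).2 t := hasFDerivAt_snd.comp_hasDerivAt t (hc t).1
    exact hv t ▸ this
  have := is_const_of_deriv_eq_zero (fun t => (hd t).differentiableAt) (fun t => (hd t).deriv) s t
  rw [← (hc s).2, ← (hc t).2]
  exact this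

theorem noContractibleReebOrbit_productBoundary (A : Set Plane) :
    NoContractibleReebOrbit (productBoundary A) := by
  intro T hT γ hγ hnull
  choose v hv hvel using hγ
  have hp : ∀ t : ℝ, (γ (t : AddCircle T) : Phase).2 = (γ (0 : ℝ) : Phase).2 := fun t =>
    snd_eq_of_hasVelocityAt (γ := fun s : ℝ => (γ (s : AddCircle T) : Phase)) hvel
      (fun t => (hv t).snd_eq_zero (γ t).2) t 0
  set p : Plane := (γ ((0 : ℝ) : AddCircle T) : Phase).2
  have hlift : ∀ i, ∃ c : C(AddCircle T, ℝ),
      ∀ x, (c x : UnitAddCircle) = (γ x : Phase).1 i := fun i => by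
    have := hnull.comp_right
      (⟨fun y => (y : Phase).1 i, by fun_prop⟩ : C(productBoundary A, UnitAddCircle))
    obtain ⟨c, hc⟩ := exists_lift_of_nullhomotopic this
    exact ⟨c, hc⟩
  choose c hc using hlift
  have hproj : ∀ t : ℝ, proj (WithLp.toLp 2 fun i => c i t, p) = γ (t : AddCircle T) := fun t => by
    ext i
    · exact hc i t
    · exact congrArg (fun x : Plane => x i) (hp t).symm
  have hder : ∀ t : ℝ, HasDerivAt (fun s : ℝ => (WithLp.toLp 2 fun i => c i s, p)) (v t) t := by
    refine fun t => (hvel t).hasDerivAt_lift (Continuous.continuousAt ?_) (.of_forall hproj)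
    refine Continuous.prodMk ((PiLp.continuous_toLp 2 _).comp (continuous_pi fun i => ?_))
      continuous_const
    exact (c i).continuous.comp (AddCircle.continuous_mk' T)
  have hcoord : ∀ i (t : ℝ), HasDerivAt (fun s : ℝ => c i s) ((v t).1 i) t := fun i t =>
    ((PiLp.proj 2 (fun _ : Fin 2 => ℝ) i : Plane →L[ℝ] ℝ).hasFDerivAt.comp_hasDerivAt t
      (hasFDerivAt_fst.comp_hasDerivAt t (hder t)) :)
  -- Action minus elapsed time is conserved, because `λ` of the Reeb vector is `1`.
  have haction : ∀ t : ℝ, HasDerivAt (fun s : ℝ => ∑ i, p i * c i s - s) 0 t := fun t => by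
    have h1 : ∑ i, p i * (v t).1 i = 1 := by
      have := (hv t).lam_eq
      rwa [lam, hp t] at this
    have := (HasDerivAt.fun_sum fun i (_ : i ∈ Finset.univ) =>
      (hcoord i t).const_mul (p i)).sub (hasDerivAt_id t)
    rw [h1, sub_self] at this
    exact this
  have := is_const_of_deriv_eq_zero (fun t => (haction t).differentiableAt)
    (fun t => (haction t).deriv) 0 T
  -- Each `c i` is a function on `AddCircle T`, so its values at `0` and `T` agree and only `T = 0`
  -- is left.
  simp [AddCircle.coe_period] at this
  linarith

/-! ### Defining functions, tangent spaces and Reeb vectors -/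

/-- Near `p`, the function `f` of class `C^k` cuts out the boundary of `A`, which contains `p` and
is transverse to the radial direction at `p`. -/
structure IsDefiningFunction (k : WithTop ℕ∞) (A : Set Plane) (p : Plane) (f : Plane → ℝ) :
    Prop where
  mem : p ∈ frontier A
  contDiffAt : ContDiffAt ℝ k f p
  frontier_iff : ∀ᶠ x in 𝓝 p, x ∈ frontier A ↔ f x = 0
  radial_pos : 0 < fderiv ℝ f p p

theorem eventually_radial_pos {f : Plane → ℝ} {p : Plane} (hf : ContDiffAt ℝ 1 f p)
    (hpos : 0 < fderiv ℝ f p p) : ∀ᶠ x in 𝓝 p, 0 < fderiv ℝ f x x :=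
  ((hf.continuousAt_fderiv one_ne_zero).clm_apply continuousAt_id).eventually_const_lt hpos

/-- Where `f ≠ 0` continuity puts a point in the interior of `A` or of its complement. An interior
point of `A` with `f = 0` would be a local maximum of `f`, against the positive radial derivative.
-/
theorem IsStarShapedDomain.exists_isDefiningFunction {k : WithTop ℕ∞} (hk : 1 ≤ k)
    {A : Set Plane} (hA : IsStarShapedDomain k A) {p : Plane} (hp : p ∈ frontier A) :
    ∃ f, IsDefiningFunction k A p f := by
  obtain ⟨f, hf, hfA, hpos⟩ := hA.boundary p hp
  have hf1 : ContDiffAt ℝ 1 f p := hf.of_le hk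
  refine ⟨f, hp, hf, ?_, hpos⟩
  filter_upwards [hfA.eventually_nhds, hf1.eventually (by simp),
    eventually_radial_pos hf1 hpos] with x hxA hx hxpos
  have hcont : ContinuousAt f x := hx.continuousAt
  constructor
  · rintro ⟨hcl, hint⟩
    refine le_antisymm (not_lt.1 fun hlt => ?_) (not_lt.1 fun hlt => hint ?_)
    · obtain ⟨z, hz, hz'⟩ := (mem_closure_iff_frequently.1 hcl).and_eventually
        ((hcont.eventually_const_lt hlt).and hxA) |>.exists
      exact hz'.1.not_ge (hz'.2.1 hz)
    · rw [mem_interior_iff_mem_nhds]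
      filter_upwards [hcont.eventually_lt_const hlt, hxA] with z hz hz'
      exact hz'.2 hz.le
  · intro h0
    refine ⟨subset_closure (hxA.self_of_nhds.2 h0.le), fun hint => hxpos.ne' ?_⟩
    have hmax : IsLocalMax f x := by
      filter_upwards [mem_interior_iff_mem_nhds.1 hint, hxA] with z hz hz'
      exact h0 ▸ hz'.1 hz
    rw [hmax.fderiv_eq_zero]
    rfl

namespace IsDefiningFunction

variable {k : WithTop ℕ∞} {A : Set Plane} {p : Plane} {f : Plane → ℝ}

theorem of_le {l : WithTop ℕ∞} (h : IsDefiningFunction k A p f) (hl : l ≤ k) :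
    IsDefiningFunction l A p f :=
  ⟨h.mem, h.contDiffAt.of_le hl, h.frontier_iff, h.radial_pos⟩

/-- Lets a single `f` serve along a whole curve in the boundary near `p`, as differentiating the
flow requires. -/
theorem eventually (h : IsDefiningFunction 1 A p f) :
    ∀ᶠ x in 𝓝 p, x ∈ frontier A → IsDefiningFunction 1 A x f := by
  filter_upwards [h.contDiffAt.eventually (by simp), h.frontier_iff.eventually_nhds,
    eventually_radial_pos h.contDiffAt h.radial_pos] with x h1 h2 h3 hx
  exact ⟨hx, h1, h2, h3⟩

theorem fderiv_apply (f : Plane → ℝ) (x w : Plane) :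
    fderiv ℝ f x w = fderiv ℝ f x (EuclideanSpace.single 0 1) * w 0 +
      fderiv ℝ f x (EuclideanSpace.single 1 1) * w 1 := by
  conv_lhs => rw [show w = w 0 • EuclideanSpace.single 0 1 + w 1 • EuclideanSpace.single 1 1 by
    ext i; fin_cases i <;> simp]
  simp only [map_add, map_smul, smul_eq_mul]
  ring

/-- Every vector in the kernel of the differential of `f` is the velocity of a curve in the
boundary. -/
theorem exists_curve (h : IsDefiningFunction 1 A p f) {w : Plane} (hw : fderiv ℝ f p w = 0) :
    ∃ c : ℝ → Plane, (∀ s, c s ∈ frontier A) ∧ c 0 = p ∧ HasDerivAt c w 0 := by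
  have hstrict : HasStrictFDerivAt f (fderiv ℝ f p) p := h.contDiffAt.hasStrictFDerivAt (by simp)
  have hsurj : (fderiv ℝ f p).range = ⊤ := by
    refine LinearMap.range_eq_top.2 (LinearMap.surjective fun h0 => h.radial_pos.ne' ?_)
    exact congrArg (fun L : Plane →ₗ[ℝ] ℝ => L p) h0
  let w' : (fderiv ℝ f p).ker := ⟨w, hw⟩
  -- `g` parametrizes the level set over the kernel of the differential, with derivative the
  -- inclusion at `0`; the curve is the image of the line through `w`.
  let g := hstrict.implicitFunction f (fderiv ℝ f p) hsurj (f p)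
  let c : ℝ → Plane := fun s => g (s • w')
  have hc0 : c 0 = p := by
    simp only [c, g, zero_smul]
    exact hstrict.implicitFunction_apply_image hsurj
  have hline : HasDerivAt (fun s : ℝ => s • w') w' 0 := by
    simpa using (hasDerivAt_id (0 : ℝ)).smul_const w'
  have hc : HasDerivAt c w 0 := by
    have hg : HasFDerivAt g (fderiv ℝ f p).ker.subtypeL ((0 : ℝ) • w') := by
      rw [zero_smul]
      exact (hstrict.to_implicitFunction hsurj).hasFDerivAt
    exact hg.comp_hasDerivAt (0 : ℝ) hline
  have hfp : f p = 0 := h.frontier_iff.self_of_nhds.1 h.mem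
  have hmem : ∀ᶠ s in 𝓝 (0 : ℝ), c s ∈ frontier A := by
    have h1 : Tendsto (fun s : ℝ => (f p, s • w')) (𝓝 0) (𝓝 (f p, 0)) := by
      refine tendsto_const_nhds.prodMk_nhds ?_
      simpa using hline.continuousAt.tendsto
    have h2 := h1.eventually (hstrict.map_implicitFunction_eq hsurj)
    have h3 : Tendsto c (𝓝 0) (𝓝 p) := hc0 ▸ hc.continuousAt.tendsto
    filter_upwards [h2, h3.eventually h.frontier_iff] with s hs hs'
    exact hs'.2 (hs.trans hfp)
  classical
  -- Curves in `tangentVectors` must stay in the set for all times, so `c` is replaced by `p`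
  -- wherever it leaves the frontier.
  refine ⟨fun s => if c s ∈ frontier A then c s else p, fun s => ?_, ?_, ?_⟩
  · dsimp only
    split_ifs with hs
    exacts [hs, h.mem]
  · simp [hc0]
  · refine hc.congr_of_eventuallyEq ?_
    filter_upwards [hmem] with s hs
    simp [hs]

theorem mem_tangentVectors_iff (hk : 1 ≤ k) {y : Phase} (h : IsDefiningFunction k A y.2 f)
    {v : TVec} : v ∈ tangentVectors (productBoundary A) y ↔ fderiv ℝ f y.2 v.2 = 0 := by
  replace h := h.of_le hk
  constructor
  · rintro ⟨r, hr, rfl, c, hc, hcr⟩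
    have h0 : (c 0).2 = (r 0).2 := congrArg Prod.snd hcr.self_of_nhds
    have hc2 : HasDerivAt (Prod.snd ∘ c) v.2 0 := hasFDerivAt_snd.comp_hasDerivAt (0 : ℝ) hc
    have hf : HasFDerivAt f (fderiv ℝ f (r 0).2) ((c 0).2) := by
      rw [h0]
      exact (h.contDiffAt.differentiableAt (by simp)).hasFDerivAt
    have hfc : HasDerivAt (fun s => f (c s).2) (fderiv ℝ f (r 0).2 v.2) 0 :=
      hf.comp_hasDerivAt (0 : ℝ) hc2
    have hzero : (fun s => f (c s).2) =ᶠ[𝓝 0] fun _ => (0 : ℝ) := by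
      have ht : Tendsto (fun s => (c s).2) (𝓝 0) (𝓝 (r 0).2) := h0 ▸ hc2.continuousAt.tendsto
      filter_upwards [ht.eventually h.frontier_iff, hcr] with s hs hs'
      refine hs.1 ?_
      have := hr s
      rw [← hs'] at this
      exact this
    exact hfc.unique ((hasDerivAt_const (0 : ℝ) (0 : ℝ)).congr_of_eventuallyEq hzero)
  · intro hv
    obtain ⟨c, hcA, hc0, hc⟩ := h.exists_curve hv
    choose b hb using fun i => QuotientAddGroup.mk_surjective (y.1 i)
    refine ⟨fun s => proj (WithLp.toLp 2 b + s • v.1, c s), hcA, ?_,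
      fun s => (WithLp.toLp 2 b + s • v.1, c s), ?_, .of_forall fun _ => rfl⟩
    · ext i
      · simp [proj, hb]
      · simp [proj, hc0]
    · refine HasDerivAt.prodMk ?_ hc
      simpa using ((hasDerivAt_id (0 : ℝ)).smul_const v.1).const_add (WithLp.toLp 2 b)

end IsDefiningFunction

/-- The gradient of `f` at `x` divided by its inner product with `x`; on the boundary, this is the
direction of the Reeb vector field. -/
noncomputable def reebDirection (f : Plane → ℝ) (x : Plane) : Plane :=
  WithLp.toLp 2 fun i => fderiv ℝ f x (EuclideanSpace.single i 1) / fderiv ℝ f x x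

theorem sum_mul_reebDirection {f : Plane → ℝ} {x : Plane} (w : Plane) :
    ∑ i, w i * reebDirection f x i = fderiv ℝ f x w / fderiv ℝ f x x := by
  rw [IsDefiningFunction.fderiv_apply f x w]
  simp only [reebDirection, Fin.sum_univ_two]
  ring

theorem sum_mul_reebDirection_self {f : Plane → ℝ} {x : Plane} (hx : 0 < fderiv ℝ f x x) :
    ∑ i, x i * reebDirection f x i = 1 := by
  rw [sum_mul_reebDirection, div_self hx.ne']

namespace IsDefiningFunction

variable {k : WithTop ℕ∞} {A : Set Plane} {f : Plane → ℝ}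

theorem isReebVector (hk : 1 ≤ k) {y : Phase} (h : IsDefiningFunction k A y.2 f) :
    IsReebVector (productBoundary A) y (reebDirection f y.2, 0) := by
  refine ⟨?_, sum_mul_reebDirection_self h.radial_pos, fun w hw => ?_⟩
  · rw [h.mem_tangentVectors_iff hk]
    simp
  · rw [h.mem_tangentVectors_iff hk] at hw
    have := sum_mul_reebDirection (f := f) (x := y.2) w.2
    rw [hw, zero_div] at this
    simp only [Fin.sum_univ_two] at this
    simp only [dlam, Fin.sum_univ_two, PiLp.zero_apply]
    linear_combination -this

theorem isReebVector_iff (hk : 1 ≤ k) {y : Phase} (h : IsDefiningFunction k A y.2 f) {v : TVec} :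
    IsReebVector (productBoundary A) y v ↔ v = (reebDirection f y.2, 0) := by
  refine ⟨fun hv => ?_, fun hv => hv ▸ h.isReebVector hk⟩
  have hv2 : v.2 = 0 := hv.snd_eq_zero h.mem
  have hlam := hv.lam_eq
  have hpos := h.radial_pos
  set a := fderiv ℝ f y.2 (EuclideanSpace.single 0 1) with ha
  set b := fderiv ℝ f y.2 (EuclideanSpace.single 1 1) with hb
  -- The rotated gradient spans the tangent line of the boundary. With `λ(v) = 1` this gives two
  -- linear equations for `v.1`, of determinant `⟨p, ∇f⟩ > 0`, solved below by Cramer's rule.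
  have htan := hv.dlam_eq (0, !₂[-b, a]) (by
    rw [h.mem_tangentVectors_iff hk, fderiv_apply, ← ha, ← hb]
    simp
    ring)
  rw [fderiv_apply, ← ha, ← hb] at hpos
  simp only [dlam, lam, Fin.sum_univ_two, hv2] at htan hlam
  simp at htan
  refine Prod.ext ?_ hv2
  ext i
  simp only [reebDirection]
  rw [fderiv_apply f y.2 y.2, ← ha, ← hb, eq_div_iff hpos.ne']
  fin_cases i
  · simp only [Fin.zero_eta, ← ha]
    linear_combination a * hlam + y.2 1 * htan
  · simp only [Fin.mk_one, ← hb]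
    linear_combination b * hlam - y.2 0 * htan

end IsDefiningFunction

/-! ### The Reeb flow and its linearization -/

/-- The rotation of `p` by a right angle in the clockwise direction. -/
def clockwise (p : Plane) : Plane := !₂[p 1, -p 0]

theorem eq_smul_clockwise {p w : Plane} (hp : p ≠ 0) (h : ∑ i, p i * w i = 0) :
    ∃ c : ℝ, w = c • clockwise p := by
  have hpos : 0 < p 0 ^ 2 + p 1 ^ 2 := by
    by_contra! hle
    refine hp ?_
    ext i
    fin_cases i
    · simp only [Fin.zero_eta, PiLp.zero_apply]; nlinarith [sq_nonneg (p 0), sq_nonneg (p 1)]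
    · simp only [Fin.mk_one, PiLp.zero_apply]; nlinarith [sq_nonneg (p 0), sq_nonneg (p 1)]
  rw [Fin.sum_univ_two] at h
  refine ⟨(w 0 * p 1 - w 1 * p 0) / (p 0 ^ 2 + p 1 ^ 2), ?_⟩
  ext i
  fin_cases i
  · simp [clockwise]
    field_simp
    linear_combination p 0 * h
  · simp [clockwise]
    field_simp
    linear_combination p 1 * h

/-- The velocity of a curve in the boundary is tangent to it. -/
theorem HasVelocityAt.mem_tangentVectors {Y : Set Phase} {r : ℝ → Phase} (hr : ∀ s, r s ∈ Y)
    {v : TVec} (h : HasVelocityAt r v 0) : v ∈ tangentVectors Y (r 0) :=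
  ⟨r, hr, rfl, h⟩

namespace IsDefiningFunction

variable {k : WithTop ℕ∞} {A : Set Plane} {f : Plane → ℝ}

theorem ne_zero {p : Plane} (h : IsDefiningFunction k A p f) : p ≠ 0 := by
  rintro rfl
  simpa using h.radial_pos

/-- The Reeb flow translates each torus with constant speed. -/
theorem reebFlow_apply (hk : 1 ≤ k) {φ : ℝ → Phase → Phase}
    (hφ : IsReebFlow (productBoundary A) φ)
    {x : Plane × Plane} (h : IsDefiningFunction k A x.2 f) (t : ℝ) :
    φ t (proj x) = proj (x.1 + t • reebDirection f x.2, x.2) := by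
  have hmem : proj x ∈ productBoundary A := h.mem
  choose v hv hvel using hφ.velocity (proj x) hmem
  have hv2 : ∀ t, (v t).2 = 0 := fun t => (hv t).snd_eq_zero (hφ.mem t _ hmem)
  have hp : ∀ t, (φ t (proj x)).2 = x.2 := fun t =>
    (snd_eq_of_hasVelocityAt hvel hv2 t 0).trans (by rw [hφ.zero _ hmem]; rfl)
  have hveq : ∀ t, v t = (reebDirection f x.2, 0) := fun t => by
    have h' : IsDefiningFunction k A (φ t (proj x)).2 f := by rwa [hp t]
    have := (h'.isReebVector_iff hk).1 (hv t)
    rwa [hp t] at this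
  obtain ⟨c, hc⟩ := exists_lift_of_hasVelocityAt hvel
  -- A lift of the orbit minus the expected linear motion is constant.
  have hd : ∀ t, HasDerivAt (fun s => c s - s • (reebDirection f x.2, (0 : Plane))) 0 t := by
    intro t
    have := (hc t).1.sub ((hasDerivAt_id t).smul_const (reebDirection f x.2, (0 : Plane)))
    rwa [hveq t, one_smul, sub_self] at this
  have hconst := is_const_of_deriv_eq_zero (fun t => (hd t).differentiableAt)
    (fun t => (hd t).deriv) t 0
  have h0 : proj (c 0) = proj x := by rw [(hc 0).2, hφ.zero _ hmem]
  rw [zero_smul, sub_zero, sub_eq_iff_eq_add] at hconst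
  rw [← (hc t).2, hconst, proj_add_eq_proj_add h0]
  congr 1
  ext i <;> simp

/-- The differential of the Reeb direction maps tangent vectors to multiples of
`p₂ ∂_{q₁} - p₁ ∂_{q₂}`. -/
theorem exists_fderiv_reebDirection {p w : Plane} (h : IsDefiningFunction 2 A p f)
    (hw : fderiv ℝ f p w = 0) :
    DifferentiableAt ℝ (reebDirection f) p ∧
      ∃ κ : ℝ, fderiv ℝ (reebDirection f) p w = κ • clockwise p := by
  have hf' : DifferentiableAt ℝ (fderiv ℝ f) p :=
    (h.contDiffAt.fderiv_right (m := 1) (by norm_num)).differentiableAt (by simp)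
  have hrad : DifferentiableAt ℝ (fun x => fderiv ℝ f x x) p := hf'.clm_apply differentiableAt_id
  have hd : DifferentiableAt ℝ (reebDirection f) p := by
    refine (PiLp.continuousLinearEquiv 2 ℝ (fun _ : Fin 2 => ℝ)).symm.differentiableAt.comp p
      (differentiableAt_pi.2 fun i => ?_)
    have hi : DifferentiableAt ℝ (fun x => fderiv ℝ f x (EuclideanSpace.single i 1)) p :=
      hf'.clm_apply (differentiableAt_const _)
    simpa only [div_eq_mul_inv] using hi.fun_mul (hrad.fun_inv h.radial_pos.ne')
  refine ⟨hd, eq_smul_clockwise h.ne_zero ?_⟩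
  have hline : HasDerivAt (fun s : ℝ => p + s • w) w 0 := by
    simpa using ((hasDerivAt_id (0 : ℝ)).smul_const w).const_add p
  have hR : HasDerivAt (fun s : ℝ => reebDirection f (p + s • w))
      (fderiv ℝ (reebDirection f) p w) 0 := by
    have : HasFDerivAt (reebDirection f) (fderiv ℝ (reebDirection f) p) (p + (0 : ℝ) • w) := by
      simpa using hd.hasFDerivAt
    exact this.comp_hasDerivAt (0 : ℝ) hline
  have hcoord : ∀ (c : ℝ → Plane) (c' : Plane), HasDerivAt c c' 0 → ∀ i,
      HasDerivAt (fun s => c s i) (c' i) 0 := fun c c' hc i =>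
    (PiLp.proj 2 (fun _ : Fin 2 => ℝ) i : Plane →L[ℝ] ℝ).hasFDerivAt.comp_hasDerivAt (0 : ℝ) hc
  have hsum := HasDerivAt.fun_sum fun i (_ : i ∈ (Finset.univ : Finset (Fin 2))) =>
    (hcoord _ _ hline i).mul (hcoord _ _ hR i)
  have hone : (fun s : ℝ => ∑ i, (p + s • w) i * reebDirection f (p + s • w) i) =ᶠ[𝓝 0]
      fun _ => (1 : ℝ) := by
    have ht : Tendsto (fun s : ℝ => p + s • w) (𝓝 0) (𝓝 p) := by
      simpa using hline.continuousAt.tendsto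
    filter_upwards [ht.eventually (eventually_radial_pos (h.contDiffAt.of_le (by norm_num))
      h.radial_pos)] with s hs using sum_mul_reebDirection_self hs
  -- The product rule at `s = 0` reads `⟨w, R⟩ + ⟨p, DR w⟩ = 0`, and `⟨w, R⟩` is a multiple of
  -- `fderiv ℝ f p w = 0`.
  have := hsum.unique ((hasDerivAt_const (0 : ℝ) (1 : ℝ)).congr_of_eventuallyEq hone)
  simp only [zero_smul, add_zero, Finset.sum_add_distrib, sum_mul_reebDirection, hw, zero_div,
    zero_add] at this
  exact this

/-- The image under the Reeb flow of a curve in the boundary. -/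
theorem hasVelocityAt_reebFlow {φ : ℝ → Phase → Phase} (hφ : IsReebFlow (productBoundary A) φ)
    {r : ℝ → Phase} (hr : ∀ s, r s ∈ productBoundary A)
    (h : IsDefiningFunction 2 A (r 0).2 f) {v : TVec} (hv : HasVelocityAt r v 0) (t : ℝ) :
    HasVelocityAt (φ t ∘ r)
      (v.1 + t • fderiv ℝ (reebDirection f) (r 0).2 v.2, v.2) 0 := by
  have hw := (h.mem_tangentVectors_iff (by norm_num)).1 (hv.mem_tangentVectors hr)
  have hd := (h.exists_fderiv_reebDirection hw).1.hasFDerivAt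
  have h1 : IsDefiningFunction 1 A (r 0).2 f := h.of_le (by norm_num)
  obtain ⟨c, hc, hcr⟩ := hv
  have h0 : (c 0).2 = (r 0).2 := congrArg Prod.snd hcr.self_of_nhds
  have hc1 : HasDerivAt (Prod.fst ∘ c) v.1 0 := hasFDerivAt_fst.comp_hasDerivAt (0 : ℝ) hc
  have hc2 : HasDerivAt (Prod.snd ∘ c) v.2 0 := hasFDerivAt_snd.comp_hasDerivAt (0 : ℝ) hc
  refine ⟨fun s => ((c s).1 + t • reebDirection f (c s).2, (c s).2), ?_, ?_⟩
  · rw [← h0] at hd ⊢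
    exact (hc1.add ((hd.comp_hasDerivAt (0 : ℝ) hc2).const_smul t)).prodMk hc2
  · have ht : Tendsto (fun s => (c s).2) (𝓝 0) (𝓝 (r 0).2) := h0 ▸ hc2.continuousAt.tendsto
    filter_upwards [hcr, ht.eventually h1.eventually] with s hs hs'
    have hmem : (c s).2 ∈ frontier A := by
      have := hr s
      rw [← hs] at this
      exact this
    rw [Function.comp_apply, ← hs, (hs' hmem).reebFlow_apply le_rfl hφ]

end IsDefiningFunction

/-! ### The canonical frame -/

/-- The unit vector tangent to the level set of `f` through `p`, in the counterclockwise
direction. -/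
noncomputable def unitTangent (f : Plane → ℝ) (p : Plane) : Plane :=
  ‖clockwise (reebDirection f p)‖⁻¹ • -clockwise (reebDirection f p)

theorem clockwise_eq_zero {p : Plane} (h : clockwise p = 0) : p = 0 := by
  have h0 := congrArg (fun x : Plane => x 0) h
  have h1 := congrArg (fun x : Plane => x 1) h
  ext i
  fin_cases i
  · simpa [clockwise] using h1
  · simpa [clockwise] using h0

namespace IsDefiningFunction

variable {k : WithTop ℕ∞} {A : Set Plane} {f : Plane → ℝ}

theorem reebDirection_ne_zero {p : Plane} (h : IsDefiningFunction k A p f) :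
    reebDirection f p ≠ 0 := by
  intro h0
  have := sum_mul_reebDirection_self h.radial_pos
  simp [h0] at this

/-- Tangency makes the second vector `c • clockwise R`; the unit norm fixes `|c|`, and `dλ(e₁, e₂) =
-c ⟨p, R⟩ = -c` fixes the sign. The frame thus depends on `p` alone and is constant along Reeb
orbits. -/
theorem isCanonicalFrame_iff (hk : 1 ≤ k) {y : Phase} (h : IsDefiningFunction k A y.2 f)
    {e : Fin 2 → TVec} : IsCanonicalFrame (productBoundary A) y e ↔
      e = ![(clockwise y.2, 0), (0, unitTangent f y.2)] := by
  have hR := sum_mul_reebDirection_self h.radial_pos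
  have hRne := h.reebDirection_ne_zero
  have hnorm : 0 < ‖clockwise (reebDirection f y.2)‖ :=
    norm_pos_iff.2 fun h0 => hRne (clockwise_eq_zero h0)
  have hpos := h.radial_pos
  rw [Fin.sum_univ_two] at hR
  constructor
  · intro he
    have htan := (h.mem_tangentVectors_iff hk).1 he.tangent
    have horth : ∑ i, reebDirection f y.2 i * (e 1).2 i = 0 := by
      simp_rw [mul_comm (reebDirection f y.2 _)]
      rw [sum_mul_reebDirection, htan, zero_div]
    obtain ⟨c, hc⟩ := eq_smul_clockwise hRne horth
    have hor := he.orientation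
    have hunit := he.unit
    rw [hc, norm_smul, Real.norm_eq_abs] at hunit
    simp only [dlam, he.first, hc, Fin.sum_univ_two, clockwise] at hor
    simp at hor
    have hneg : c < 0 := by
      by_contra! hc0
      nlinarith
    rw [abs_of_neg hneg] at hunit
    have hceq : c = -‖clockwise (reebDirection f y.2)‖⁻¹ := by
      field_simp
      linarith
    funext i
    fin_cases i
    · exact he.first
    · refine Prod.ext he.vertical ?_
      simp [hc, hceq, unitTangent]
  · rintro rfl
    refine ⟨rfl, ?_, rfl, ?_, ?_⟩
    · rw [h.mem_tangentVectors_iff hk]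
      have hz : ∑ i, clockwise (reebDirection f y.2) i * reebDirection f y.2 i = 0 := by
        simp [clockwise]
        ring
      rw [sum_mul_reebDirection, div_eq_zero_iff, or_iff_left hpos.ne'] at hz
      simp [unitTangent, hz]
    · simp [unitTangent, norm_smul, hnorm.ne']
    · have : dlam (clockwise y.2, 0) (0, unitTangent f y.2) =
          ‖clockwise (reebDirection f y.2)‖⁻¹ := by
        simp only [dlam, unitTangent, clockwise, Fin.sum_univ_two] at hR ⊢
        simp
        linear_combination ‖!₂[reebDirection f y.2 1, -reebDirection f y.2 0]‖⁻¹ * hR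
      simpa [this] using hnorm

end IsDefiningFunction

/-! ### The rotation number of a path of shears -/

theorem dir_eq_dir_iff {x y : ℝ} : dir x = dir y ↔ ∃ n : ℤ, x = y + n := by
  constructor
  · intro h
    have hc : Real.cos (2 * Real.pi * x) = Real.cos (2 * Real.pi * y) := congrFun h 0
    have hs : Real.sin (2 * Real.pi * x) = Real.sin (2 * Real.pi * y) := congrFun h 1
    obtain ⟨n, hn⟩ := Real.Angle.angle_eq_iff_two_pi_dvd_sub.1 (Real.Angle.cos_sin_inj hc hs)
    refine ⟨n, ?_⟩
    have := Real.pi_ne_zero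
    have h2 : 2 * Real.pi * (x - y - n) = 0 := by linear_combination hn
    have h3 := (mul_eq_zero.1 h2).resolve_left (by positivity)
    linarith
  · rintro ⟨n, rfl⟩
    have : 2 * Real.pi * (y + n) = 2 * Real.pi * y + n * (2 * Real.pi) := by ring
    simp [dir, this, Real.cos_add_int_mul_two_pi, Real.sin_add_int_mul_two_pi]

theorem dir_eq_of_smul_eq {x y c d : ℝ} (hc : 0 < c) (hd : 0 < d) (h : c • dir x = d • dir y) :
    dir x = dir y := by
  have h0 : c * Real.cos (2 * Real.pi * x) = d * Real.cos (2 * Real.pi * y) := congrFun h 0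
  have h1 : c * Real.sin (2 * Real.pi * x) = d * Real.sin (2 * Real.pi * y) := congrFun h 1
  have hx := Real.sin_sq_add_cos_sq (2 * Real.pi * x)
  have hy := Real.sin_sq_add_cos_sq (2 * Real.pi * y)
  have hsq : c ^ 2 = d ^ 2 := by
    linear_combination -c ^ 2 * hx + d ^ 2 * hy
      + (c * Real.cos (2 * Real.pi * x) + d * Real.cos (2 * Real.pi * y)) * h0
      + (c * Real.sin (2 * Real.pi * x) + d * Real.sin (2 * Real.pi * y)) * h1
  obtain rfl : c = d := by nlinarith [(sq_eq_sq₀ hc.le hd.le).1 hsq]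
  exact smul_right_injective _ hc.ne' h

theorem shear_mulVec_dir (s x : ℝ) : !![1, s; 0, 1] *ᵥ dir x =
    ![Real.cos (2 * Real.pi * x) + s * Real.sin (2 * Real.pi * x), Real.sin (2 * Real.pi * x)] := by
  ext i
  fin_cases i <;> simp [dir, Matrix.mulVec, dotProduct, Fin.sum_univ_two]

/-- The quotient of the image of the direction at angle `x` under the shear by that direction. -/
noncomputable def shearFactor (s x : ℝ) : ℂ :=
  ⟨1 + s * Real.sin (2 * Real.pi * x) * Real.cos (2 * Real.pi * x),
    -(s * Real.sin (2 * Real.pi * x) ^ 2)⟩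

/-- A shear never reverses a direction: the imaginary part vanishes only for fixed directions, where
the factor is `1`. The principal argument is therefore a continuous choice of angle. -/
theorem shearFactor_mem_slitPlane (s x : ℝ) : shearFactor s x ∈ Complex.slitPlane := by
  rw [Complex.mem_slitPlane_iff]
  by_cases h : s * Real.sin (2 * Real.pi * x) ^ 2 = 0
  · left
    have : s * Real.sin (2 * Real.pi * x) = 0 := by
      rcases mul_eq_zero.1 h with h | h
      · simp [h]
      · simp [pow_eq_zero_iff (two_ne_zero) |>.1 h]
    simp [shearFactor, this]
  · exact .inr (by simpa [shearFactor] using h)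

theorem continuous_shearFactor : Continuous fun z : ℝ × ℝ => shearFactor z.1 z.2 := by
  refine Complex.equivRealProdCLM.symm.continuous.comp (f := fun z : ℝ × ℝ =>
    (1 + z.1 * Real.sin (2 * Real.pi * z.2) * Real.cos (2 * Real.pi * z.2),
      -(z.1 * Real.sin (2 * Real.pi * z.2) ^ 2))) ?_
  fun_prop

/-- The lift to angles, in full turns, of the action of the shear. -/
noncomputable def shearLift (s x : ℝ) : ℝ := x + Complex.arg (shearFactor s x) / (2 * Real.pi)

theorem continuous_shearLift : Continuous fun z : ℝ × ℝ => shearLift z.1 z.2 := by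
  refine continuous_snd.add (Continuous.div_const ?_ _)
  exact continuous_iff_continuousAt.2 fun z =>
    ContinuousAt.comp (f := fun z : ℝ × ℝ => shearFactor z.1 z.2)
      (Complex.continuousAt_arg (shearFactor_mem_slitPlane z.1 z.2))
      continuous_shearFactor.continuousAt

theorem shearLift_zero_left (x : ℝ) : shearLift 0 x = x := by
  have : shearFactor 0 x = 1 := by apply Complex.ext <;> simp [shearFactor]
  simp [shearLift, this]

theorem shearLift_zero_right (s : ℝ) : shearLift s 0 = 0 := by
  have : shearFactor s 0 = 1 := by apply Complex.ext <;> simp [shearFactor]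
  simp [shearLift, this]

theorem shearLift_add_int (s x : ℝ) (n : ℤ) : shearLift s (x + n) = shearLift s x + n := by
  have h : dir (x + n) = dir x := dir_eq_dir_iff.2 ⟨n, rfl⟩
  have hc : Real.cos (2 * Real.pi * (x + n)) = Real.cos (2 * Real.pi * x) := congrFun h 0
  have hs : Real.sin (2 * Real.pi * (x + n)) = Real.sin (2 * Real.pi * x) := congrFun h 1
  simp only [shearLift, shearFactor, hc, hs]
  ring

theorem exists_shear_mulVec_dir (s x : ℝ) :
    ∃ c : ℝ, 0 < c ∧ !![1, s; 0, 1] *ᵥ dir x = c • dir (shearLift s x) := by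
  have hne := Complex.slitPlane_ne_zero (shearFactor_mem_slitPlane s x)
  have hpi := Real.pi_ne_zero
  refine ⟨‖shearFactor s x‖, norm_pos_iff.2 hne, ?_⟩
  have hang : 2 * Real.pi * shearLift s x = 2 * Real.pi * x + (shearFactor s x).arg := by
    rw [shearLift]
    field_simp
  have hcos := Complex.norm_mul_cos_arg (shearFactor s x)
  have hsin := Complex.norm_mul_sin_arg (shearFactor s x)
  have h1 := Real.sin_sq_add_cos_sq (2 * Real.pi * x)
  rw [shear_mulVec_dir]
  simp only [dir, hang, Real.cos_add, Real.sin_add]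
  set N := ‖shearFactor s x‖
  set C := Real.cos (2 * Real.pi * x)
  set S := Real.sin (2 * Real.pi * x)
  have hre : (shearFactor s x).re = 1 + s * S * C := rfl
  have him : (shearFactor s x).im = -(s * S ^ 2) := rfl
  rw [hre] at hcos
  rw [him] at hsin
  ext i
  fin_cases i
  · simp
    linear_combination -C * hcos + S * hsin - s * S * h1
  · simp
    linear_combination -S * hcos - C * hsin

/-- The opposite shear inverts the action, so `x` and `y` differ by an integer, which
`shearLift_add_int` forces to be `0`. -/
theorem shearLift_injective (s : ℝ) : Function.Injective (shearLift s) := by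
  intro x y hxy
  obtain ⟨c, hc, hcx⟩ := exists_shear_mulVec_dir s x
  obtain ⟨d, hd, hdy⟩ := exists_shear_mulVec_dir s y
  have hinv : ∀ v : Fin 2 → ℝ, !![1, -s; 0, 1] *ᵥ !![1, s; 0, 1] *ᵥ v = v := fun v => by
    rw [Matrix.mulVec_mulVec]
    ext i
    fin_cases i <;> simp [Matrix.mulVec, dotProduct, Fin.sum_univ_two]
  have h : d • dir x = c • dir y := by
    rw [← hinv (d • dir x), ← hinv (c • dir y), Matrix.mulVec_smul, Matrix.mulVec_smul _ c,
      hcx, hdy, hxy, smul_comm]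
  obtain ⟨n, rfl⟩ := dir_eq_dir_iff.1 (dir_eq_of_smul_eq hd hc h)
  rw [shearLift_add_int] at hxy
  simp only [add_eq_left] at hxy
  simp [hxy]

/-- A continuous injection of the line is strictly monotone, and the value at `1` exceeds the value
at `0` by one. -/
theorem monotone_shearLift (s : ℝ) : Monotone (shearLift s) := by
  have hcont : Continuous (shearLift s) :=
    continuous_shearLift.comp (continuous_const.prodMk continuous_id)
  rcases hcont.strictMono_of_inj (shearLift_injective s) with h | h
  · exact h.monotone
  · have h01 := h one_pos
    have h1 := shearLift_add_int s 0 1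
    simp only [Int.cast_one, zero_add] at h1
    linarith

/-- `shearLift` as a lift of a circle map of degree one. -/
noncomputable def shearCircleLift (s : ℝ) : CircleDeg1Lift where
  toFun := shearLift s
  monotone' := monotone_shearLift s
  map_add_one' x := by simpa using shearLift_add_int s x 1

theorem hasRotationNumber_shear_iff {Ψ : ℝ → Matrix (Fin 2) (Fin 2) ℝ} {κ T ρ : ℝ} (hT : 0 < T)
    (hΨ : ∀ t ∈ Icc 0 T, Ψ t = !![1, κ * t; 0, 1]) : HasRotationNumber Ψ T ρ ↔ ρ = 0 := by
  constructor
  · rintro ⟨F, hF, rfl⟩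
    obtain ⟨a, hac, ha0, haT, hΨa⟩ := hF 0
    -- For an arbitrary lift `F`, the angle path from `0` follows a fixed direction: it is
    -- integer-valued and continuous, hence constant, so `F 0 = 0`.
    have hint : ∀ t ∈ Icc 0 T, ∃ n : ℤ, a t = n := fun t ht => by
      obtain ⟨c, hc, h⟩ := hΨa t ht
      have hfix : Ψ t *ᵥ dir 0 = (1 : ℝ) • dir 0 := by
        rw [hΨ t ht, shear_mulVec_dir]
        simp [dir]
      obtain ⟨n, hn⟩ := dir_eq_dir_iff.1 (dir_eq_of_smul_eq hc one_pos (h.symm.trans hfix))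
      exact ⟨n, by simpa using hn⟩
    have hZ : IsTotallyDisconnected (range ((↑) : ℤ → ℝ)) :=
      (countable_range _).isTotallyDisconnected
    have himage : (a '' Icc 0 T).Subsingleton := by
      refine hZ _ ?_ (isPreconnected_Icc.image a hac)
      rintro _ ⟨t, ht, rfl⟩
      exact (hint t ht).imp fun n hn => hn.symm
    have h0T : a T = a 0 := himage (mem_image_of_mem _ ⟨hT.le, le_rfl⟩)
      (mem_image_of_mem _ ⟨le_rfl, hT.le⟩)
    have hF0 : F 0 = 0 + ((0 : ℤ) : ℝ) := by rw [← haT, h0T, ha0]; simp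
    simpa using F.translationNumber_of_eq_add_int hF0
  · rintro rfl
    refine ⟨shearCircleLift (κ * T), fun x => ⟨fun t => shearLift (κ * t) x, ?_, ?_, rfl,
      fun t ht => ?_⟩, ?_⟩
    · exact (continuous_shearLift.comp (f := fun t : ℝ => (κ * t, x)) (by fun_prop)).continuousOn
    · simp [shearLift_zero_left]
    · rw [hΨ t ht]
      exact exists_shear_mulVec_dir _ _
    · have h0 : shearCircleLift (κ * T) 0 = 0 + ((0 : ℤ) : ℝ) :=
        (shearLift_zero_right (κ * T)).trans (by simp)
      simpa using CircleDeg1Lift.translationNumber_of_eq_add_int _ h0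

/-! ### The Ruelle invariant -/

/-- In canonical frames the linearized Reeb flow is a path of shears. -/
theorem hasLinearizedMatrix_reebFlow {A : Set Plane} (hA : IsStarShapedDomain 2 A)
    {φ : ℝ → Phase → Phase}
    {τ : Phase → Fin 2 → TVec} (hφ : IsReebFlow (productBoundary A) φ)
    (hτ : ∀ y ∈ productBoundary A, IsCanonicalFrame (productBoundary A) y (τ y))
    {y : Phase} (hy : y ∈ productBoundary A) :
    ∃ κ : ℝ, ∀ t : ℝ, HasLinearizedMatrix (productBoundary A) (φ t) y
      (τ y) (τ (φ t y)) !![1, κ * t; 0, 1] := by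
  have h2 : (1 : WithTop ℕ∞) ≤ 2 := by norm_num
  obtain ⟨f, hf⟩ := hA.exists_isDefiningFunction h2 hy
  obtain ⟨x, rfl⟩ := exists_proj_eq y
  have hτy := (hf.isCanonicalFrame_iff h2).1 (hτ _ hy)
  have htan : fderiv ℝ f x.2 (unitTangent f x.2) = 0 := by
    have := (hf.mem_tangentVectors_iff h2).1 (hτ _ hy).tangent
    rwa [hτy] at this
  obtain ⟨κ, hκ⟩ : ∃ κ : ℝ, fderiv ℝ (reebDirection f) x.2 (unitTangent f x.2) =
      κ • clockwise x.2 := (hf.exists_fderiv_reebDirection htan).2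
  refine ⟨κ, fun t a r hr hr0 hv => ?_⟩
  have hφx : (φ t (proj x)).2 = x.2 := by rw [hf.reebFlow_apply h2 hφ]; rfl
  have hτt : τ (φ t (proj x)) = τ (proj x) := by
    have hf' : IsDefiningFunction 2 A (φ t (proj x)).2 f := by rw [hφx]; exact hf
    rw [(hf'.isCanonicalFrame_iff h2).1 (hτ _ (hφ.mem t _ hy)), hτy, hφx]
    rfl
  have hr2 : (r 0).2 = x.2 := congrArg Prod.snd hr0
  have hfr : IsDefiningFunction 2 A (r 0).2 f := by rw [hr2]; exact hf
  have key := hfr.hasVelocityAt_reebFlow hφ hr hv t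
  convert key using 1
  rw [hτt, hr2, hτy]
  have h1 : (∑ i, a i • (![(clockwise (proj x).2, 0), (0, unitTangent f (proj x).2)] :
      Fin 2 → TVec) i) = (a 0 • clockwise x.2, a 1 • unitTangent f x.2) := by
    simp [Fin.sum_univ_two, proj]
  rw [h1]
  simp only [map_smul, hκ]
  simp only [Fin.sum_univ_two, Matrix.mulVec, dotProduct, proj, Matrix.of_apply,
    Matrix.cons_val_zero, Matrix.cons_val_one]
  ext i <;> simp
  ring

/-- The matrix of the differential with respect to canonical frames is unique. -/
theorem HasLinearizedMatrix.unique {A : Set Plane} {k : WithTop ℕ∞} (hk : 1 ≤ k)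
    (hA : IsStarShapedDomain k A)
    {F : Phase → Phase} {y : Phase} {e e' : Fin 2 → TVec} {M N : Matrix (Fin 2) (Fin 2) ℝ}
    (hy : y ∈ productBoundary A) (hFy : F y ∈ productBoundary A)
    (he : IsCanonicalFrame (productBoundary A) y e)
    (he' : IsCanonicalFrame (productBoundary A) (F y) e')
    (hM : HasLinearizedMatrix (productBoundary A) F y e e' M)
    (hN : HasLinearizedMatrix (productBoundary A) F y e e' N) : M = N := by
  obtain ⟨f, hf⟩ := hA.exists_isDefiningFunction hk hy
  obtain ⟨f', hf'⟩ := hA.exists_isDefiningFunction hk hFy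
  have hindep : ∀ a b : Fin 2 → ℝ, ∑ i, a i • e' i = ∑ i, b i • e' i → a = b := fun a b hab => by
    have hne : clockwise (F y).2 ≠ 0 := fun h => hf'.ne_zero (clockwise_eq_zero h)
    have hne' : (e' 1).2 ≠ 0 := fun h => by simpa [h] using he'.unit
    have hfirst : e' 0 = (clockwise (F y).2, 0) := he'.first
    rw [Fin.sum_univ_two, Fin.sum_univ_two, hfirst] at hab
    have hab1 := congrArg Prod.fst hab
    have hab2 := congrArg Prod.snd hab
    simp only [Prod.fst_add, Prod.snd_add, Prod.smul_fst, Prod.smul_snd, he'.vertical, smul_zero,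
      add_zero, zero_add] at hab1 hab2
    ext i
    fin_cases i
    · exact smul_left_injective ℝ hne hab1
    · exact smul_left_injective ℝ hne' hab2
  have hvec : ∀ a : Fin 2 → ℝ, M *ᵥ a = N *ᵥ a := fun a => by
    have htan : ∑ i, a i • e i ∈ tangentVectors (productBoundary A) y := by
      rw [hf.mem_tangentVectors_iff hk, Fin.sum_univ_two]
      have := (hf.mem_tangentVectors_iff hk).1 he.tangent
      simp [he.first, this]
    obtain ⟨r, hr, hr0, hv⟩ := htan
    exact hindep _ _ ((hM a r hr hr0 hv).unique (hN a r hr hr0 hv))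
  exact Matrix.ext_of_mulVec_single fun i => hvec _

/-- Uniqueness of the matrix forces every admissible `Ψ` to be the shear path for `t ≥ 0`, so the
rate does not depend on the choice of `Ψ`. -/
theorem hasRotationRate_iff {A : Set Plane} (hA : IsStarShapedDomain 2 A)
    {φ : ℝ → Phase → Phase}
    {τ : Phase → Fin 2 → TVec} (hφ : IsReebFlow (productBoundary A) φ)
    (hτ : ∀ y ∈ productBoundary A, IsCanonicalFrame (productBoundary A) y (τ y))
    {y : Phase} (hy : y ∈ productBoundary A) {ω : ℝ} :
    HasRotationRate (productBoundary A) φ τ y ω ↔ ω = 0 := by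
  obtain ⟨κ, hκ⟩ := hasLinearizedMatrix_reebFlow hA hφ hτ hy
  constructor
  · rintro ⟨Ψ, hΨ, ρ, hρ, hlim⟩
    have hshear : ∀ t, 0 ≤ t → Ψ t = !![1, κ * t; 0, 1] := fun t ht =>
      (hΨ t ht).unique (by norm_num) hA hy (hφ.mem t y hy) (hτ y hy) (hτ _ (hφ.mem t y hy)) (hκ t)
    refine tendsto_nhds_unique (hlim.congr' ?_) tendsto_const_nhds
    filter_upwards [eventually_gt_atTop 0] with T hT
    rw [(hasRotationNumber_shear_iff hT fun t ht => hshear t ht.1).1 (hρ T hT), zero_div]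
  · rintro rfl
    exact ⟨fun t => !![1, κ * t; 0, 1], fun t _ => hκ t, 0,
      fun T hT => (hasRotationNumber_shear_iff hT fun _ _ => rfl).2 rfl, by simp⟩

theorem ae_contactVolume_mem_productBoundary (A : Set Plane) (τ : Phase → Fin 2 → TVec) :
    ∀ᵐ y ∂(contactVolume A τ), y ∈ productBoundary A :=
  (withDensity_absolutelyContinuous _ _).ae_le
    (Measure.quasiMeasurePreserving_snd.ae (ae_restrict_mem isClosed_frontier.measurableSet))

theorem exists_isReebFlow {A : Set Plane} {k : WithTop ℕ∞} (hk : 1 ≤ k)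
    (hA : IsStarShapedDomain k A) :
    ∃ φ, IsReebFlow (productBoundary A) φ := by
  -- The choices of `f` need no compatibility: `p` is conserved, so each orbit uses a single `f`.
  choose! f hf using fun p hp => hA.exists_isDefiningFunction hk (p := p) hp
  choose x hx using exists_proj_eq
  have hx2 : ∀ y, (x y).2 = y.2 := fun y => congrArg Prod.snd (hx y)
  refine ⟨fun t y => proj ((x y).1 + t • reebDirection (f y.2) y.2, y.2), fun t y hy => hy,
    fun y hy => ?_, fun y hy t => ⟨(reebDirection (f y.2) y.2, 0), ?_,
      fun s => ((x y).1 + s • reebDirection (f y.2) y.2, y.2), ?_, .of_forall fun _ => rfl⟩⟩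
  · simp only [zero_smul, add_zero, ← hx2 y]
    exact hx y
  · exact IsDefiningFunction.isReebVector (f := f y.2) hk
      (y := proj ((x y).1 + t • reebDirection (f y.2) y.2, y.2)) (hf _ hy)
  · refine HasDerivAt.prodMk ?_ (hasDerivAt_const _ _)
    simpa using ((hasDerivAt_id t).smul_const (reebDirection (f y.2) y.2)).const_add (x y).1

theorem exists_isCanonicalFrame {A : Set Plane} {k : WithTop ℕ∞} (hk : 1 ≤ k)
    (hA : IsStarShapedDomain k A) :
    ∃ τ : Phase → Fin 2 → TVec,
      ∀ y ∈ productBoundary A, IsCanonicalFrame (productBoundary A) y (τ y) := by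
  choose! f hf using fun p hp => hA.exists_isDefiningFunction hk (p := p) hp
  exact ⟨fun y => ![(clockwise y.2, 0), (0, unitTangent (f y.2) y.2)], fun y hy =>
    ((hf _ hy).isCanonicalFrame_iff hk).2 rfl⟩

/-- The equivalence carries well-definedness: every choice of flow, frame and rate function
integrates to `0`, and such a choice exists. -/
theorem hasRuelleInvariant_iff {A : Set Plane} (hA : IsStarShapedDomain 2 A) {c : ℝ} :
    HasRuelleInvariant A c ↔ c = 0 := by
  constructor
  · rintro ⟨φ, τ, rot, hφ, hτ, hrot, -, rfl⟩
    refine integral_eq_zero_of_ae ?_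
    filter_upwards [hrot, ae_contactVolume_mem_productBoundary A τ] with y hy hyA
    exact (hasRotationRate_iff hA hφ hτ hyA).1 hy
  · rintro rfl
    obtain ⟨φ, hφ⟩ := exists_isReebFlow (by norm_num) hA
    obtain ⟨τ, hτ⟩ := exists_isCanonicalFrame (by norm_num) hA
    refine ⟨φ, τ, 0, hφ, hτ, ?_, integrable_zero _ _ _, by simp⟩
    filter_upwards [ae_contactVolume_mem_productBoundary A τ] with y hy
    exact (hasRotationRate_iff hA hφ hτ hy).2 rfl

end CotangentTorus

theorem proposition3p1 (A : Set CotangentTorus.Plane)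
    (hA : CotangentTorus.IsStarShapedDomain 1 A) :
    CotangentTorus.NoContractibleReebOrbit (CotangentTorus.productBoundary A) ∧
    CotangentTorus.IsDynamicallyConvex (CotangentTorus.productBoundary A) ∧
    (CotangentTorus.IsStarShapedDomain 2 A →
      (∀ (φ : ℝ → CotangentTorus.Phase → CotangentTorus.Phase)
          (τ : CotangentTorus.Phase → Fin 2 → CotangentTorus.TVec),
        CotangentTorus.IsReebFlow (CotangentTorus.productBoundary A) φ →
        (∀ y ∈ CotangentTorus.productBoundary A,
          CotangentTorus.IsCanonicalFrame (CotangentTorus.productBoundary A) y (τ y)) →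
        ∀ y ∈ CotangentTorus.productBoundary A, ∃ κ : ℝ, ∀ t : ℝ,
          CotangentTorus.HasLinearizedMatrix (CotangentTorus.productBoundary A) (φ t) y
            (τ y) (τ (φ t y)) !![1, κ * t; 0, 1]) ∧
      ∀ c : ℝ, CotangentTorus.HasRuelleInvariant A c ↔ c = 0) :=
  ⟨CotangentTorus.noContractibleReebOrbit_productBoundary A,
    .inl (CotangentTorus.noContractibleReebOrbit_productBoundary A), fun hA2 =>
      ⟨fun _ _ hφ hτ _ hy => CotangentTorus.hasLinearizedMatrix_reebFlow hA2 hφ hτ hy,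
        fun _ => CotangentTorus.hasRuelleInvariant_iff hA2⟩⟩
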